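/- Let $I$ be a homogeneous ideal in the standard graded polynomial ring $R=\mathbb{C}[x_1,\dots,x_N]$ and let $\prec$ be any term order on the monomials of $R$. **The degree.** If the projective zero locus $V(I)\subseteq\mathbb{P}^{N-1}$ is nonempty of dimension $d$ (i.e. $R/I$ has Krull dimension $d+1\ge 1$), then $\deg V(I)$ is $d!$ times the leading coefficient of the Hilbert polynomial of $R/I$, the polynomial that agrees with $k\mapsto\dim_{\mathbb{C}}(R/I)_k$ for all large $k$. For every homogeneous $I$, including the case $V(I)=\emptyset$, the degree of $R/I$ is the coefficient of the lowest-degree term of $K_{R/I}(1-t)$, where the polynomial $K_{R/I}$ is defined by $\sum_{k\ge0}\dim_{\mathbb{C}}(R/I)_k\,t^k=K_{R/I}(t)/(1-t)^N$ (and this coefficient is $0$ when $K_{R/I}=0$, that is, when $I=R$). **The tablet.** Let $J=\mathrm{init}_\prec(I)$ be the ideal generated by the leading terms of the elements of $I$, with minimal monomial generators $g_1,\dots,g_s$, $g_j=\prod_{i=1}^N x_i^{a_{ij}}$. Put $m_i=\max_j a_{ij}$ (and $m_i=0$ if $J=0$). The polarization of $J$ is the squarefree monomial ideal $\widetilde J=\langle\widetilde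 g_1,\dots,\widetilde g_s\rangle$, $\widetilde g_j=\prod_{i=1}^N\prod_{k=1}^{a_{ij}}x_{ik}$, in $\widetilde R=\mathbb{C}[x_{ik}: 1\le i\le N,\ 1\le k\le m_i]$. Each minimal prime of $\widetilde J$ is generated by variables; its hieroglyph is the set of variables that it contains. The tablet $\mathcal{T}(V(I),\prec)$ is the set of those hieroglyphs that have the fewest elements among all hieroglyphs of $\widetilde J$. **Theorem.** If $V(I)\neq\emptyset$, then $R/I$ has a Hilbert polynomial and $$\deg V(I)=\#\mathcal{T}(V(I),\prec).$$ For every homogeneous ideal $I$ the polynomial $K_{R/I}$ exists, and the degree of $R/I$ (the lowest-degree coefficient of $K_{R/I}(1-t)$) equals $\#\mathcal{T}(V(I),\prec)$. Moreover, if $J$ is already radical, then the number of hieroglyphs is the same when the tablet is formed from $J$ itself instead of $\widetilde J$. -/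

import Mathlib

attribute [local instance] MvPolynomial.gradedAlgebra

namespace Tablet

open MvPolynomial

/-! ### Hilbert function, Hilbert polynomial, K-polynomial -/

/-- The Hilbert function `k ↦ dim_ℂ (R/I)_k` of `R/I`, where `R = ℂ[x_1, …, x_N]` is standard
graded and `(R/I)_k` is the image of the space of homogeneous polynomials of degree `k`. -/
noncomputable def hilbertFunction {N : ℕ} (I : Ideal (MvPolynomial (Fin N) ℂ)) (k : ℕ) : ℕ :=
  Module.finrank ℂ
    ((homogeneousSubmodule (Fin N) ℂ k).map (Ideal.Quotient.mkₐ ℂ I).toLinearMap)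

/-- `h` is the Hilbert polynomial of `R/I`: it agrees with the Hilbert function at all
sufficiently large integers. (There is at most one such polynomial.) -/
def IsHilbertPolynomial {N : ℕ} (I : Ideal (MvPolynomial (Fin N) ℂ)) (h : Polynomial ℚ) : Prop :=
  ∀ᶠ k : ℕ in Filter.atTop, h.eval (k : ℚ) = (hilbertFunction I k : ℚ)

/-- The Hilbert series `∑ₖ dim_ℂ (R/I)_k t^k`. -/
noncomputable def hilbertSeries {N : ℕ} (I : Ideal (MvPolynomial (Fin N) ℂ)) : PowerSeries ℤ :=
  PowerSeries.mk fun k => (hilbertFunction I k : ℤ)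

/-- `K` is the K-polynomial of `R/I`: the Hilbert series of `R/I` is `K(t) / (1 - t)^N`.
(There is at most one such polynomial.) -/
def IsKPolynomial {N : ℕ} (I : Ideal (MvPolynomial (Fin N) ℂ)) (K : Polynomial ℤ) : Prop :=
  hilbertSeries I * (1 - PowerSeries.X) ^ N = (K : PowerSeries ℤ)

/-! ### Initial ideal -/

/-- The initial ideal of `I`, generated by the leading terms of the elements of `I` with respect
to the term order `m`. -/
noncomputable def initialIdeal {N : ℕ} (m : MonomialOrder (Fin N))
    (I : Ideal (MvPolynomial (Fin N) ℂ)) : Ideal (MvPolynomial (Fin N) ℂ) :=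
  Ideal.span (m.leadingTerm '' (I : Set (MvPolynomial (Fin N) ℂ)))

/-! ### Polarization -/

/-- The exponent vectors of the minimal monomial generators of a monomial ideal `J`: the minimal
elements, for divisibility, among the monomials in `J`. -/
def minGenerators {N : ℕ} (J : Ideal (MvPolynomial (Fin N) ℂ)) : Set (Fin N →₀ ℕ) :=
  {a | Minimal (fun b : Fin N →₀ ℕ => monomial b (1 : ℂ) ∈ J) a}

theorem minGenerators_finite {N : ℕ} (J : Ideal (MvPolynomial (Fin N) ℂ)) :
    (minGenerators J).Finite :=
  WellQuasiOrderedLE.finite_of_isAntichain (setOfPred_minimal_antichain _)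

/-- The largest exponent `m_i` of `x_i` in a minimal monomial generator of `J`. -/
noncomputable def maxExponent {N : ℕ} (J : Ideal (MvPolynomial (Fin N) ℂ)) (i : Fin N) : ℕ :=
  (minGenerators_finite J).toFinset.sup fun a => a i

/-- The variables `x_{i1}, …, x_{i m_i}`, `1 ≤ i ≤ N`, of the enlarged polynomial ring.
The variable `x_{i,k+1}` is the pair `⟨i, k⟩`. -/
abbrev PolarVar {N : ℕ} (J : Ideal (MvPolynomial (Fin N) ℂ)) : Type :=
  Σ i : Fin N, Fin (maxExponent J i)

/-- The polarization of the monomial ideal `J`: each minimal generator `∏ᵢ x_i ^ a_i` is replaced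
by the squarefree monomial `∏ᵢ x_{i1} x_{i2} ⋯ x_{i a_i}`. -/
noncomputable def polarization {N : ℕ} (J : Ideal (MvPolynomial (Fin N) ℂ)) :
    Ideal (MvPolynomial (PolarVar J) ℂ) :=
  Ideal.span ((fun a : Fin N →₀ ℕ =>
    ∏ i : Fin N, ∏ k ∈ Finset.univ.filter (fun k : Fin (maxExponent J i) => (k : ℕ) < a i),
      (X (⟨i, k⟩ : PolarVar J) : MvPolynomial (PolarVar J) ℂ)) '' minGenerators J)

/-! ### Hieroglyphs and tablets -/

/-- The hieroglyph of a prime ideal `P` generated by variables: the set of variables lying in `P`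
(the positions of the `+` signs). -/
def hieroglyph {τ : Type} (P : Ideal (MvPolynomial τ ℂ)) : Set τ :=
  {v | (X v : MvPolynomial τ ℂ) ∈ P}

/-- The hieroglyphs of the components of the prime decomposition of a squarefree monomial ideal,
that is, of its minimal primes. -/
def hieroglyphs {τ : Type} (J : Ideal (MvPolynomial τ ℂ)) : Set (Set τ) :=
  hieroglyph '' J.minimalPrimes

/-- The tablet of a squarefree monomial ideal in finitely many variables: its hieroglyphs with
the minimum number of `+` signs. -/
def tablet {τ : Type} (J : Ideal (MvPolynomial τ ℂ)) : Set (Set τ) :=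
  {H | H ∈ hieroglyphs J ∧ ∀ H' ∈ hieroglyphs J, H.ncard ≤ H'.ncard}

end Tablet

/-! # The degree of a homogeneous ideal is the size of its tablet

Let `J` be the initial ideal of `I` and let `m_i` be the largest exponent of `x_i` in a minimal
generator of `J`. Whether `x^a` lies in `J` depends only on the truncation `c = min(a, m)`, because
every minimal generator divides `x^m` (`monomial_inf_lcmExponent_mem_iff`). So the monomials outside
`J` are the disjoint union, over the finitely many `c ≤ m` with `x^c ∉ J` (`standardBox`), of the
translates `c + ℕ^S`, where `S = {i | c_i = m_i}` (`freeVars`). By Macaulay's theorem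
(`hilbertFunction_eq_card`) these monomials count the Hilbert function of `R/I`, and the
decomposition gives
`K_{R/I}(t) = ∑_c t^|c| (1 - t)^(N - |S_c|)`. If `D` is the largest value of `|S_c|` (`maxFree`), the
lowest term of `K_{R/I}(1 - t)` is therefore `t^(N - D)`, with the number of `c` satisfying
`|S_c| = D` (`topBox`) as its coefficient. The same number is `(D - 1)!` times the leading
coefficient of the Hilbert polynomial `∑_c binom(k - |c| + |S_c| - 1, |S_c| - 1)`, summed over the
`c` with `S_c` nonempty.

On the other side, the hieroglyphs of a squarefree monomial ideal are the minimal vertex covers of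
its generators, and the tablet consists of the covers with the fewest elements
(`tablet_span_prod_X`). A minimal cover of the polarization uses at most one variable
`x_{i, c_i + 1}` for each `i`. Putting `c_i = m_i` for the indices that are not used, the covers of
this shape correspond to the elements `c` of the standard box, and the cover of `c` has `N - |S_c|`
elements. Hence the tablet is in bijection with `topBox` (`tablet_polarization_eq`).

It remains to see that `D` is the Krull dimension of `R/I`, so that the degree of the Hilbert
polynomial is the right one (`ringKrullDim_quotient_eq_maxFree`). Noether normalization makes `R/I`
finite over a polynomial ring in `s = dim R/I` variables. Comparing the growth of that polynomial
ring with the count of standard monomials gives `s ≤ D` (`le_maxFree_of_injective`). Conversely the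
`D` free variables of a top element are algebraically independent modulo `I`, which gives `D ≤ s`
(`card_le_of_finite_of_injective`).

If `J` is radical, its minimal generators are squarefree and polarization only renames variables
and drops those that occur in no generator, so the smallest covers correspond
(`ncard_minCovers_map`).
-/

namespace Tablet

open MvPolynomial

/-! ### Standard monomials and the Hilbert function -/

theorem monomial_mem_initialIdeal_iff {N : ℕ} (m : MonomialOrder (Fin N))
    (I : Ideal (MvPolynomial (Fin N) ℂ)) (a : Fin N →₀ ℕ) :
    monomial a (1 : ℂ) ∈ initialIdeal m I ↔ ∃ f ∈ I, f ≠ 0 ∧ m.degree f = a := by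
  rw [initialIdeal, m.span_leadingTerm_eq_span_monomial',
    ← Set.image_image (fun d => monomial d (1 : ℂ)) m.degree, mem_ideal_span_monomial_image]
  constructor
  · intro h
    obtain ⟨_, ⟨f, ⟨hf, hf0⟩, rfl⟩, hle⟩ := h a (by simp [mem_support_iff])
    have hm : monomial (a - m.degree f) (1 : ℂ) ≠ 0 := by simp
    refine ⟨monomial (a - m.degree f) 1 * f, I.mul_mem_left _ hf, mul_ne_zero hm hf0, ?_⟩
    rw [m.degree_mul hm hf0, m.degree_monomial, if_neg one_ne_zero, tsub_add_cancel_of_le hle]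
  · rintro ⟨f, hf, hf0, rfl⟩ b hb
    obtain rfl : m.degree f = b := by
      by_contra hne
      simp [mem_support_iff, coeff_monomial, hne] at hb
    exact ⟨_, ⟨f, ⟨hf, hf0⟩, rfl⟩, le_rfl⟩

theorem monomial_mem_of_le {N : ℕ} {J : Ideal (MvPolynomial (Fin N) ℂ)} {a b : Fin N →₀ ℕ}
    (hab : a ≤ b) (ha : monomial a (1 : ℂ) ∈ J) : monomial b (1 : ℂ) ∈ J := by
  have h : monomial b (1 : ℂ) = monomial (b - a) 1 * monomial a 1 := by
    rw [monomial_mul, tsub_add_cancel_of_le hab, one_mul]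
  exact h ▸ J.mul_mem_left _ ha

/-- The monomials outside the initial ideal are linearly independent modulo the ideal, because
the leading monomial of a nonzero element of the ideal lies in the initial ideal. -/
theorem linearIndependent_standard {N : ℕ} (m : MonomialOrder (Fin N))
    (I : Ideal (MvPolynomial (Fin N) ℂ)) :
    LinearIndependent ℂ (fun a : {a : Fin N →₀ ℕ // monomial a (1 : ℂ) ∉ initialIdeal m I} =>
      Ideal.Quotient.mkₐ ℂ I (monomial a.1 1)) := by
  have hli : LinearIndependent ℂ
      (fun a : {a : Fin N →₀ ℕ // monomial a (1 : ℂ) ∉ initialIdeal m I} =>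
        (monomial a.1 1 : MvPolynomial (Fin N) ℂ)) := by
    have h := (basisMonomials (Fin N) ℂ).linearIndependent.comp
      (Subtype.val : {a : Fin N →₀ ℕ // monomial a (1 : ℂ) ∉ initialIdeal m I} → _)
      Subtype.val_injective
    rw [coe_basisMonomials] at h
    exact h
  refine hli.map (f := (Ideal.Quotient.mkₐ ℂ I).toLinearMap) (Submodule.disjoint_def.2 ?_)
  intro f hf hfI
  have hfI' : f ∈ I := by simpa [Ideal.Quotient.eq_zero_iff_mem] using hfI
  by_contra hf0
  have hsupp : ∀ b ∈ f.support, monomial b (1 : ℂ) ∉ initialIdeal m I := by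
    have hle : Submodule.span ℂ (Set.range
        (fun a : {a : Fin N →₀ ℕ // monomial a (1 : ℂ) ∉ initialIdeal m I} =>
          (monomial a.1 1 : MvPolynomial (Fin N) ℂ))) ≤
        restrictSupport ℂ {b | monomial b (1 : ℂ) ∉ initialIdeal m I} := by
      rw [restrictSupport_eq_span]
      refine Submodule.span_mono ?_
      rintro _ ⟨a, rfl⟩
      exact ⟨a.1, a.2, rfl⟩
    have := hle hf
    rw [mem_restrictSupport_iff] at this
    exact fun b hb => this hb
  exact hsupp _ (m.degree_mem_support hf0)
    ((monomial_mem_initialIdeal_iff m I _).2 ⟨f, hfI', hf0, rfl⟩)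

/-- Division with remainder inside one degree: modulo a homogeneous ideal, a form of degree `k`
is a combination of the monomials of degree `k` outside the initial ideal. -/
theorem mk_mem_span_standard {N : ℕ} (m : MonomialOrder (Fin N))
    {I : Ideal (MvPolynomial (Fin N) ℂ)}
    (hI : I.IsHomogeneous (homogeneousSubmodule (Fin N) ℂ)) {k : ℕ}
    (f : MvPolynomial (Fin N) ℂ) (hf : f.IsHomogeneous k) :
    Ideal.Quotient.mkₐ ℂ I f ∈ Submodule.span ℂ
      ((fun a : Fin N →₀ ℕ => Ideal.Quotient.mkₐ ℂ I (monomial a 1)) ''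
        {a | a.degree = k ∧ monomial a (1 : ℂ) ∉ initialIdeal m I}) := by
  set W := Submodule.span ℂ ((fun a : Fin N →₀ ℕ => Ideal.Quotient.mkₐ ℂ I (monomial a 1)) ''
    {a | a.degree = k ∧ monomial a (1 : ℂ) ∉ initialIdeal m I}) with hW
  induction hs : m.toSyn (m.degree f) using WellFoundedLT.induction generalizing f with
  | ind s ih =>
    subst hs
    by_cases hf0 : f = 0
    · simp [hf0]
    have hak : (m.degree f).degree = k :=
      (hf.degree_eq_sum_deg_support (m.degree_mem_support hf0)).symm ▸ rfl
    -- a form with the same leading monomial, whose class is already known to lie in `W`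
    obtain ⟨g, hg, hgd, hga, hgW⟩ : ∃ g : MvPolynomial (Fin N) ℂ, g.IsHomogeneous k ∧
        m.toSyn (m.degree g) ≤ m.toSyn (m.degree f) ∧ coeff (m.degree f) g ≠ 0 ∧
        Ideal.Quotient.mkₐ ℂ I g ∈ W := by
      by_cases hstd : monomial (m.degree f) (1 : ℂ) ∈ initialIdeal m I
      · obtain ⟨g, hgI, hg0, hgf⟩ := (monomial_mem_initialIdeal_iff m I _).1 hstd
        refine ⟨homogeneousComponent k g, homogeneousComponent_isHomogeneous k g, ?_, ?_, ?_⟩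
        · rw [← hgf]
          refine m.degree_le_degree_of_support_subset fun b hb => ?_
          rw [support_homogeneousComponent] at hb
          exact (Finset.mem_filter.1 hb).1
        · rw [coeff_homogeneousComponent, if_pos hak, ← hgf]
          exact m.coeff_degree_ne_zero_iff.2 hg0
        · have : Ideal.Quotient.mkₐ ℂ I (homogeneousComponent k g) = 0 :=
            Ideal.Quotient.eq_zero_iff_mem.2 (homogeneousComponent_mem_of_mem hI hgI k)
          rw [this]
          exact W.zero_mem
      · refine ⟨monomial (m.degree f) 1, isHomogeneous_monomial _ hak, ?_, by simp,
          Submodule.subset_span ⟨_, ⟨hak, hstd⟩, rfl⟩⟩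
        exact m.degree_monomial_le 1
    set c := m.leadingCoeff f / coeff (m.degree f) g with hc
    have hsplit : f = (f - c • g) + c • g := by ring
    rw [hsplit, map_add, map_smul]
    refine W.add_mem ?_ (W.smul_mem c hgW)
    by_cases h0 : f - c • g = 0
    · rw [h0, map_zero]; exact W.zero_mem
    refine ih _ ?_ _ (hf.sub ((homogeneousSubmodule (Fin N) ℂ k).smul_mem c hg)) rfl
    have hmem := m.degree_mem_support h0
    have hle : m.toSyn (m.degree (f - c • g)) ≤ m.toSyn (m.degree f) := by
      refine m.degree_sub_le.trans (sup_le le_rfl (m.degree_smul_le.trans hgd))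
    refine lt_of_le_of_ne hle fun heq => ?_
    rw [m.toSyn.injective heq, mem_support_iff, coeff_sub, coeff_smul, smul_eq_mul, hc,
      div_mul_cancel₀ _ hga] at hmem
    exact hmem (sub_self _)

open scoped Classical in
/-- The Hilbert function of a homogeneous ideal counts the monomials outside its initial ideal. -/
theorem hilbertFunction_eq_card {N : ℕ} (m : MonomialOrder (Fin N))
    {I : Ideal (MvPolynomial (Fin N) ℂ)}
    (hI : I.IsHomogeneous (homogeneousSubmodule (Fin N) ℂ)) (k : ℕ) :
    hilbertFunction I k = ((Finset.univ.finsuppAntidiag k).filter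
      fun a : Fin N →₀ ℕ => monomial a (1 : ℂ) ∉ initialIdeal m I).card := by
  set T := (Finset.univ.finsuppAntidiag k).filter
      fun a : Fin N →₀ ℕ => monomial a (1 : ℂ) ∉ initialIdeal m I with hT
  have hTmem : ∀ a, a ∈ T ↔ a.degree = k ∧ monomial a (1 : ℂ) ∉ initialIdeal m I := by
    intro a
    simp [hT, Finsupp.degree_eq_sum]
  have hspan : (homogeneousSubmodule (Fin N) ℂ k).map (Ideal.Quotient.mkₐ ℂ I).toLinearMap =
      Submodule.span ℂ (Set.range fun a : T => Ideal.Quotient.mkₐ ℂ I (monomial a.1 1)) := by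
    apply le_antisymm
    · rintro _ ⟨f, hf, rfl⟩
      refine Submodule.span_mono ?_ (mk_mem_span_standard m hI f hf)
      rintro _ ⟨a, ha, rfl⟩
      exact ⟨⟨a, (hTmem a).2 ha⟩, rfl⟩
    · rw [Submodule.span_le]
      rintro _ ⟨a, rfl⟩
      exact ⟨monomial a.1 1, isHomogeneous_monomial _ ((hTmem _).1 a.2).1, rfl⟩
  have hli : LinearIndependent ℂ
      (fun a : T => Ideal.Quotient.mkₐ ℂ I (monomial a.1 1)) :=
    (linearIndependent_standard m I).comp
      (fun a : T => (⟨a.1, ((hTmem _).1 a.2).2⟩ :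
        {a : Fin N →₀ ℕ // monomial a (1 : ℂ) ∉ initialIdeal m I}))
      fun a b h => Subtype.ext (congrArg (fun x => x.1) h)
  rw [hilbertFunction, hspan, finrank_span_eq_card hli, Fintype.card_coe]

/-! ### Hieroglyphs as vertex covers -/

/-- `H` is a vertex cover (transversal) of the hypergraph `𝓕`: it meets every edge. -/
def IsCover {τ : Type*} (𝓕 : Set (Finset τ)) (H : Set τ) : Prop :=
  ∀ F ∈ 𝓕, ∃ v ∈ F, v ∈ H

/-- The vertex covers of `𝓕` with the fewest elements. (Cardinality is `Set.ncard`, so the notion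
is meaningful for finite vertex sets.) -/
def minCovers {τ : Type*} (𝓕 : Set (Finset τ)) : Set (Set τ) :=
  {H | IsCover 𝓕 H ∧ ∀ H', IsCover 𝓕 H' → H.ncard ≤ H'.ncard}

theorem X_mem_span_X_image {τ : Type*} {H : Set τ} {v : τ} :
    (X v : MvPolynomial τ ℂ) ∈ Ideal.span (X '' H) ↔ v ∈ H := by
  classical
  rw [mem_ideal_span_X_image]
  simp [support_X, Finsupp.single_apply]

/-- An ideal generated by variables is the kernel of the substitution killing these variables. -/
theorem isPrime_span_X_image {τ : Type*} (H : Set τ) :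
    (Ideal.span (X '' H) : Ideal (MvPolynomial τ ℂ)).IsPrime := by
  classical
  let φ : MvPolynomial τ ℂ →ₐ[ℂ] MvPolynomial τ ℂ := aeval fun v => if v ∈ H then 0 else X v
  have hker : RingHom.ker φ = Ideal.span (X '' H) := by
    apply le_antisymm
    · intro f hf
      have hcomp : (Ideal.Quotient.mkₐ ℂ (Ideal.span (X '' H))).comp φ =
          Ideal.Quotient.mkₐ ℂ (Ideal.span (X '' H)) := by
        ext v
        by_cases hv : v ∈ H
        · have : Ideal.Quotient.mk (Ideal.span (X '' H)) (X v : MvPolynomial τ ℂ) = 0 :=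
            Ideal.Quotient.eq_zero_iff_mem.2 (X_mem_span_X_image.2 hv)
          simp [φ, hv, this]
        · simp [φ, hv]
      refine Ideal.Quotient.eq_zero_iff_mem.1 ?_
      have := DFunLike.congr_fun hcomp f
      rw [AlgHom.comp_apply, (RingHom.mem_ker).1 hf, map_zero] at this
      exact this.symm
    · rw [Ideal.span_le]
      rintro _ ⟨v, hv, rfl⟩
      simp [φ, hv]
  exact hker ▸ RingHom.ker_isPrime φ

theorem span_prod_X_le_iff {τ : Type} {𝓕 : Set (Finset τ)} {P : Ideal (MvPolynomial τ ℂ)}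
    (hP : P.IsPrime) :
    Ideal.span ((fun F : Finset τ => ∏ v ∈ F, (X v : MvPolynomial τ ℂ)) '' 𝓕) ≤ P ↔
      IsCover 𝓕 (hieroglyph P) := by
  rw [Ideal.span_le, Set.image_subset_iff]
  exact forall₂_congr fun F _ => hP.prod_mem_iff

theorem hieroglyphs_span_prod_X {τ : Type} (𝓕 : Set (Finset τ)) :
    hieroglyphs (Ideal.span ((fun F : Finset τ => ∏ v ∈ F, (X v : MvPolynomial τ ℂ)) '' 𝓕)) =
      {H | Minimal (IsCover 𝓕) H} := by
  have hhier : ∀ H : Set τ, hieroglyph (Ideal.span (X '' H) : Ideal (MvPolynomial τ ℂ)) = H :=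
    fun H => Set.ext fun v => X_mem_span_X_image
  have hle : ∀ (H : Set τ) (P : Ideal (MvPolynomial τ ℂ)), H ⊆ hieroglyph P →
      Ideal.span (X '' H) ≤ P := by
    rintro H P h
    rw [Ideal.span_le]
    rintro _ ⟨v, hv, rfl⟩
    exact h hv
  have hcov : ∀ H : Set τ, IsCover 𝓕 H →
      Ideal.span ((fun F : Finset τ => ∏ v ∈ F, (X v : MvPolynomial τ ℂ)) '' 𝓕) ≤
        Ideal.span (X '' H) := fun H hH =>
    (span_prod_X_le_iff (isPrime_span_X_image H)).2 ((hhier H).symm ▸ hH)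
  ext H
  constructor
  · rintro ⟨P, ⟨⟨hP, hJP⟩, hmin⟩, rfl⟩
    refine ⟨(span_prod_X_le_iff hP).1 hJP, fun H' hH' hsub v hv => ?_⟩
    have := hmin ⟨isPrime_span_X_image H', hcov H' hH'⟩ (hle H' P hsub) hv
    exact X_mem_span_X_image.1 this
  · rintro ⟨hH, hmin⟩
    refine ⟨Ideal.span (X '' H), ⟨⟨isPrime_span_X_image H, hcov H hH⟩, ?_⟩, hhier H⟩
    rintro Q ⟨hQ, hJQ⟩ hQH
    refine hle H Q (hmin ((span_prod_X_le_iff hQ).1 hJQ) fun v hv => ?_)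
    exact X_mem_span_X_image.1 (hQH hv)

theorem tablet_span_prod_X {τ : Type} [Finite τ] (𝓕 : Set (Finset τ)) :
    tablet (Ideal.span ((fun F : Finset τ => ∏ v ∈ F, (X v : MvPolynomial τ ℂ)) '' 𝓕)) =
      minCovers 𝓕 := by
  rw [tablet, hieroglyphs_span_prod_X]
  ext H
  constructor
  · rintro ⟨hH, hmin⟩
    refine ⟨hH.prop, fun H' hH' => ?_⟩
    obtain ⟨H'', hle, hH''⟩ := exists_minimal_le_of_wellFoundedLT (IsCover 𝓕) H' hH'
    exact (hmin H'' hH'').trans (Set.ncard_le_ncard hle (Set.toFinite _))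
  · rintro ⟨hH, hmin⟩
    refine ⟨⟨hH, fun H' hH' hle => ?_⟩, fun H' hH' => hmin H' hH'.prop⟩
    exact (Set.eq_of_subset_of_ncard_le hle (hmin H' hH') (Set.toFinite _)).ge

/-- Isolated vertices do not occur in smallest covers. -/
theorem ncard_minCovers_map {σ τ : Type*} [Finite σ] [Finite τ] (f : σ ↪ τ)
    (𝓕 : Set (Finset σ)) :
    (minCovers (Finset.map f '' 𝓕)).ncard = (minCovers 𝓕).ncard := by
  have himg : ∀ H, IsCover 𝓕 H → IsCover (Finset.map f '' 𝓕) (f '' H) := by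
    rintro H hH _ ⟨F, hF, rfl⟩
    obtain ⟨v, hv, hvH⟩ := hH F hF
    exact ⟨f v, Finset.mem_map_of_mem f hv, v, hvH, rfl⟩
  have hpre : ∀ H, IsCover (Finset.map f '' 𝓕) H → IsCover 𝓕 (f ⁻¹' H) := by
    rintro H hH F hF
    obtain ⟨w, hw, hwH⟩ := hH _ ⟨F, hF, rfl⟩
    obtain ⟨v, hv, rfl⟩ := Finset.mem_map.1 hw
    exact ⟨v, hv, hwH⟩
  have hcard : ∀ H : Set σ, (f '' H).ncard = H.ncard :=
    fun H => Set.ncard_image_of_injective H f.injective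
  have hsub : ∀ H : Set τ, f '' (f ⁻¹' H) ⊆ H := fun H => Set.image_preimage_subset f H
  have heq : minCovers (Finset.map f '' 𝓕) = (fun H => f '' H) '' minCovers 𝓕 := by
    ext H
    constructor
    · rintro ⟨hH, hmin⟩
      have hfix : f '' (f ⁻¹' H) = H := Set.eq_of_subset_of_ncard_le (hsub H)
        (hmin _ (himg _ (hpre H hH))) (Set.toFinite _)
      refine ⟨f ⁻¹' H, ⟨hpre H hH, fun H' hH' => ?_⟩, hfix⟩
      rw [← hcard, ← hcard, hfix]
      exact hmin _ (himg H' hH')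
    · rintro ⟨H, ⟨hH, hmin⟩, rfl⟩
      refine ⟨himg H hH, fun H' hH' => ?_⟩
      calc (f '' H).ncard = H.ncard := hcard H
        _ ≤ (f ⁻¹' H').ncard := hmin _ (hpre H' hH')
        _ = (f '' (f ⁻¹' H')).ncard := (hcard _).symm
        _ ≤ H'.ncard := Set.ncard_le_ncard (hsub H') (Set.toFinite _)
  rw [heq]
  exact Set.ncard_image_of_injective _ (Set.image_injective.2 f.injective)

/-! ### Truncated standard monomials and the tablet of the polarization -/

section Box

variable {N : ℕ} (J : Ideal (MvPolynomial (Fin N) ℂ))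

/-- The exponent vector `(m_1, …, m_N)` of the least common multiple of the minimal generators. -/
noncomputable def lcmExponent : Fin N →₀ ℕ := Finsupp.equivFunOnFinite.symm (maxExponent J)

@[simp]
theorem lcmExponent_apply (i : Fin N) : lcmExponent J i = maxExponent J i := rfl

open scoped Classical in
/-- The exponents of the monomials outside `J` that divide the least common multiple of the
minimal generators. -/
noncomputable def standardBox : Finset (Fin N →₀ ℕ) :=
  (Finset.Icc 0 (lcmExponent J)).filter fun c => monomial c (1 : ℂ) ∉ J

/-- The positions where `c` attains the largest possible exponent. If `c` is in the standard box,
then multiplying `x^c` by these variables never leads into `J`. -/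
noncomputable def freeVars (c : Fin N →₀ ℕ) : Finset (Fin N) :=
  Finset.univ.filter fun i => c i = maxExponent J i

/-- The largest number of free variables of an element of the standard box. (It is `0` if `J` is
the unit ideal, when the box is empty.) -/
noncomputable def maxFree : ℕ := (standardBox J).sup fun c => (freeVars J c).card

/-- The elements of the standard box with the largest number of free variables. -/
noncomputable def topBox : Finset (Fin N →₀ ℕ) :=
  (standardBox J).filter fun c => (freeVars J c).card = maxFree J

variable {J}

theorem mem_standardBox {c : Fin N →₀ ℕ} :
    c ∈ standardBox J ↔ c ≤ lcmExponent J ∧ monomial c (1 : ℂ) ∉ J := by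
  simp [standardBox]

theorem card_freeVars_le_maxFree {c : Fin N →₀ ℕ} (hc : c ∈ standardBox J) :
    (freeVars J c).card ≤ maxFree J :=
  Finset.le_sup (f := fun c => (freeVars J c).card) hc

theorem topBox_nonempty (h : (standardBox J).Nonempty) : (topBox J).Nonempty := by
  obtain ⟨c, hc, hcD⟩ := Finset.exists_mem_eq_sup _ h fun c => (freeVars J c).card
  exact ⟨c, Finset.mem_filter.2 ⟨hc, hcD.symm⟩⟩

theorem exists_minGenerator_le {a : Fin N →₀ ℕ} (ha : monomial a (1 : ℂ) ∈ J) :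
    ∃ g ∈ minGenerators J, g ≤ a := by
  obtain ⟨g, hle, hg⟩ := exists_minimal_le_of_wellFoundedLT
    (fun b : Fin N →₀ ℕ => monomial b (1 : ℂ) ∈ J) a ha
  exact ⟨g, hg, hle⟩

theorem minGenerator_le_lcmExponent {g : Fin N →₀ ℕ} (hg : g ∈ minGenerators J) :
    g ≤ lcmExponent J := fun i =>
  Finset.le_sup (f := fun a : Fin N →₀ ℕ => a i) ((minGenerators_finite J).mem_toFinset.2 hg)

theorem monomial_mem_iff_exists_minGenerator {a : Fin N →₀ ℕ} :
    monomial a (1 : ℂ) ∈ J ↔ ∃ g ∈ minGenerators J, g ≤ a :=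
  ⟨exists_minGenerator_le, fun ⟨_, hg, hle⟩ => monomial_mem_of_le hle hg.1⟩

/-- Membership of a monomial in `J` only depends on its exponents truncated at `lcmExponent`. -/
theorem monomial_inf_lcmExponent_mem_iff {a : Fin N →₀ ℕ} :
    monomial (a ⊓ lcmExponent J) (1 : ℂ) ∈ J ↔ monomial a (1 : ℂ) ∈ J := by
  simp only [monomial_mem_iff_exists_minGenerator, le_inf_iff]
  exact ⟨fun ⟨g, hg, h⟩ => ⟨g, hg, h.1⟩,
    fun ⟨g, hg, h⟩ => ⟨g, hg, h, minGenerator_le_lcmExponent hg⟩⟩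

variable (J) in
/-- The edges of the polarization: the variables of the generator coming from `x^a`. -/
noncomputable def polarEdge (a : Fin N →₀ ℕ) : Finset (PolarVar J) :=
  Finset.univ.filter fun v => (v.2 : ℕ) < a v.1

variable (J) in
theorem polarization_eq_span : polarization J =
    Ideal.span ((fun F : Finset (PolarVar J) => ∏ v ∈ F, (X v : MvPolynomial (PolarVar J) ℂ)) ''
      (polarEdge J '' minGenerators J)) := by
  rw [polarization, Set.image_image]
  congr 2
  funext a
  rw [Finset.prod_sigma']
  refine Finset.prod_congr ?_ fun _ _ => rfl
  ext v
  simp [polarEdge]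

variable (J) in
/-- The set of polarization variables attached to a truncated exponent `c`: one variable
`x_{i, c_i + 1}` for every position `i` that is not free. -/
def boxCover (c : Fin N →₀ ℕ) : Set (PolarVar J) :=
  {v | (v.2 : ℕ) = c v.1}

theorem ncard_boxCover_add {c : Fin N →₀ ℕ} (hc : c ≤ lcmExponent J) :
    (boxCover J c).ncard + (freeVars J c).card = N := by
  have h : (boxCover J c).ncard = (freeVars J c)ᶜ.card := by
    rw [← Set.ncard_coe_finset, ← Set.InjOn.ncard_image (f := Sigma.fst) (s := boxCover J c)]
    · congr 1
      ext i
      simp only [boxCover, freeVars, Set.mem_image, Set.mem_ofPred_eq, Finset.coe_compl,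
        Finset.coe_filter, Finset.mem_univ, true_and, Set.mem_compl_iff]
      constructor
      · rintro ⟨v, hv, rfl⟩ heq
        exact absurd v.2.2 (by rw [hv, heq]; exact lt_irrefl _)
      · intro hne
        exact ⟨⟨i, ⟨c i, lt_of_le_of_ne (hc i) hne⟩⟩, rfl, rfl⟩
    · rintro ⟨i, k⟩ hk ⟨j, l⟩ hl (rfl : i = j)
      have : k = l := Fin.ext ((show (k : ℕ) = c i from hk).trans (show (l : ℕ) = c i from hl).symm)
      rw [this]
  rw [h, Finset.card_compl_add_card, Fintype.card_fin]

theorem boxCover_injOn : Set.InjOn (boxCover J) {c | c ≤ lcmExponent J} := by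
  have key : ∀ c d : Fin N →₀ ℕ, d ≤ lcmExponent J → boxCover J d ⊆ boxCover J c →
      ∀ i, c i = d i ∨ d i = lcmExponent J i := by
    intro c d hd h i
    refine or_iff_not_imp_right.2 fun hne => ?_
    have : (⟨i, ⟨d i, lt_of_le_of_ne (hd i) hne⟩⟩ : PolarVar J) ∈ boxCover J c := h rfl
    exact (show d i = c i from this).symm
  intro c hc d hd h
  ext i
  rcases key c d hd h.ge i with h1 | h1
  · exact h1
  · rcases key d c hc h.le i with h2 | h2
    · exact h2.symm
    · exact h2.trans h1.symm

theorem isCover_boxCover_iff {c : Fin N →₀ ℕ} :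
    IsCover (polarEdge J '' minGenerators J) (boxCover J c) ↔ monomial c (1 : ℂ) ∉ J := by
  rw [monomial_mem_iff_exists_minGenerator, IsCover, Set.forall_mem_image]
  push Not
  refine forall₂_congr fun g hg => ?_
  rw [Finsupp.le_def, not_forall]
  constructor
  · rintro ⟨v, hv, hvc⟩
    refine ⟨v.1, not_le.2 ?_⟩
    rw [← show (v.2 : ℕ) = c v.1 from hvc]
    exact (Finset.mem_filter.1 hv).2
  · rintro ⟨i, hi⟩
    have hlt : c i < g i := not_le.1 hi
    exact ⟨⟨i, ⟨c i, hlt.trans_le (minGenerator_le_lcmExponent hg i)⟩⟩,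
      Finset.mem_filter.2 ⟨Finset.mem_univ _, hlt⟩, rfl⟩

/-- Among the variables `x_{i1}, x_{i2}, …` in a cover only the first is needed, since an edge
containing a later one also contains the first. -/
theorem exists_boxCover_subset {H : Set (PolarVar J)}
    (hH : IsCover (polarEdge J '' minGenerators J) H) :
    ∃ c ∈ standardBox J, boxCover J c ⊆ H := by
  have hex : ∀ i : Fin N, ∃ n : ℕ, n ≤ maxExponent J i ∧
      (∀ h : n < maxExponent J i, (⟨i, ⟨n, h⟩⟩ : PolarVar J) ∈ H) ∧
      ∀ k : Fin (maxExponent J i), (⟨i, k⟩ : PolarVar J) ∈ H → n ≤ k := by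
    intro i
    set A : Set ℕ := {n | n ≤ maxExponent J i ∧
      ∀ h : n < maxExponent J i, (⟨i, ⟨n, h⟩⟩ : PolarVar J) ∈ H} with hA
    have hne : A.Nonempty := ⟨maxExponent J i, le_rfl, fun h => absurd h (lt_irrefl _)⟩
    exact ⟨sInf A, (Nat.sInf_mem hne).1, (Nat.sInf_mem hne).2,
      fun k hk => Nat.sInf_le ⟨k.2.le, fun _ => hk⟩⟩
  choose c hcle hcH hcmin using hex
  have hcov : IsCover (polarEdge J '' minGenerators J)
      (boxCover J (Finsupp.equivFunOnFinite.symm c)) := by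
    rintro _ ⟨g, hg, rfl⟩
    obtain ⟨v, hv, hvH⟩ := hH _ ⟨g, hg, rfl⟩
    have hlt : c v.1 < g v.1 := (hcmin v.1 v.2 hvH).trans_lt (Finset.mem_filter.1 hv).2
    exact ⟨⟨v.1, ⟨c v.1, hlt.trans_le (minGenerator_le_lcmExponent hg v.1)⟩⟩,
      Finset.mem_filter.2 ⟨Finset.mem_univ _, hlt⟩, rfl⟩
  refine ⟨Finsupp.equivFunOnFinite.symm c,
    mem_standardBox.2 ⟨hcle, isCover_boxCover_iff.1 hcov⟩, ?_⟩
  rintro ⟨i, k⟩ hk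
  have hk' : (k : ℕ) = c i := hk
  have hki : k = ⟨c i, hk' ▸ k.2⟩ := Fin.ext hk'
  rw [hki]
  exact hcH i _

variable (J) in
theorem tablet_polarization_eq : tablet (polarization J) = boxCover J '' (topBox J) := by
  rw [polarization_eq_span, tablet_span_prod_X]
  have hcard : ∀ c ∈ standardBox J, (boxCover J c).ncard + (freeVars J c).card = N :=
    fun c hc => ncard_boxCover_add (mem_standardBox.1 hc).1
  ext H
  constructor
  · rintro ⟨hH, hmin⟩
    obtain ⟨c, hc, hcH⟩ := exists_boxCover_subset hH
    have hmin' : ∀ c' ∈ standardBox J, H.ncard ≤ (boxCover J c').ncard := fun c' hc' =>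
      hmin _ (isCover_boxCover_iff.2 (mem_standardBox.1 hc').2)
    have heq : boxCover J c = H :=
      Set.eq_of_subset_of_ncard_le hcH (hmin' c hc) (Set.toFinite _)
    refine ⟨c, Finset.mem_coe.2 (Finset.mem_filter.2 ⟨hc, ?_⟩), heq⟩
    refine le_antisymm (card_freeVars_le_maxFree hc) (Finset.sup_le fun c' hc' => ?_)
    have h1 := hcard c hc
    have h2 := hcard c' hc'
    have h3 := hmin' c' hc'
    rw [← heq] at h3
    omega
  · rintro ⟨c, hc, rfl⟩
    obtain ⟨hc, hcD⟩ := Finset.mem_filter.1 (Finset.mem_coe.1 hc)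
    refine ⟨isCover_boxCover_iff.2 (mem_standardBox.1 hc).2, fun H' hH' => ?_⟩
    obtain ⟨c', hc', hsub⟩ := exists_boxCover_subset hH'
    refine le_trans ?_ (Set.ncard_le_ncard hsub (Set.toFinite _))
    have h1 := hcard c hc
    have h2 := hcard c' hc'
    have h3 := card_freeVars_le_maxFree hc'
    omega

variable (J) in
theorem ncard_tablet_polarization : (tablet (polarization J)).ncard = (topBox J).card := by
  rw [tablet_polarization_eq, Set.InjOn.ncard_image, Set.ncard_coe_finset]
  exact boxCover_injOn.mono fun c hc =>
    (mem_standardBox.1 (Finset.mem_filter.1 (Finset.mem_coe.1 hc)).1).1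

end Box

/-! ### Counting standard monomials -/

section Count

variable {N : ℕ} {J : Ideal (MvPolynomial (Fin N) ℂ)}

/-- The monomials with a given truncation `c` form the translate by `c` of the monomials in the
free variables of `c`. -/
theorem inf_lcmExponent_eq_iff {a c : Fin N →₀ ℕ} (hc : c ≤ lcmExponent J) :
    a ⊓ lcmExponent J = c ↔ c ≤ a ∧ (a - c).support ⊆ freeVars J c := by
  have hc' : ∀ i, c i ≤ maxExponent J i := hc
  rw [DFunLike.ext_iff, Finsupp.le_def, Finset.subset_iff, ← forall_and]
  refine forall_congr' fun i => ?_
  have := hc' i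
  simp only [Finsupp.inf_apply, lcmExponent_apply, Finsupp.mem_support_iff, Finsupp.tsub_apply,
    freeVars, Finset.mem_filter, Finset.mem_univ, true_and]
  omega

open scoped Classical in
theorem card_fiber_inf_lcmExponent {c : Fin N →₀ ℕ} (hc : c ≤ lcmExponent J) (k : ℕ) :
    ((Finset.univ.finsuppAntidiag k).filter
      fun a : Fin N →₀ ℕ => a ⊓ lcmExponent J = c).card =
      if c.degree ≤ k then (freeVars J c).card.multichoose (k - c.degree) else 0 := by
  have hmem : ∀ a : Fin N →₀ ℕ, a ∈ (Finset.univ.finsuppAntidiag k).filter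
      (fun a : Fin N →₀ ℕ => a ⊓ lcmExponent J = c) ↔
        a.degree = k ∧ c ≤ a ∧ (a - c).support ⊆ freeVars J c := by
    intro a
    simp [inf_lcmExponent_eq_iff hc, Finsupp.degree_eq_sum]
  have hdeg : ∀ a : Fin N →₀ ℕ, c ≤ a → (a - c).degree + c.degree = a.degree := by
    intro a ha
    rw [← map_add, tsub_add_cancel_of_le ha]
  have hmem' : ∀ (e : Fin N →₀ ℕ) (n : ℕ), e ∈ (freeVars J c).finsuppAntidiag n ↔
      e.degree = n ∧ e.support ⊆ freeVars J c := by
    intro e n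
    rw [Finset.mem_finsuppAntidiag]
    refine and_congr_left fun hs => ?_
    rw [Finsupp.degree_eq_sum, Finset.sum_subset (Finset.subset_univ _)]
    intro i _ hi
    exact Finsupp.notMem_support_iff.1 fun h => hi (hs h)
  split_ifs with hk
  · rw [← Finset.card_finsuppAntidiag_nat_eq_multichoose]
    refine Finset.card_nbij' (fun a => a - c) (fun e => e + c) ?_ ?_ ?_ ?_
    · intro a ha
      obtain ⟨h1, h2, h3⟩ := (hmem a).1 ha
      have := hdeg a h2
      exact (hmem' _ _).2 ⟨show (a - c).degree = k - c.degree by omega, h3⟩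
    · intro e he
      obtain ⟨h1, h2⟩ := (hmem' e _).1 he
      refine (hmem _).2 ⟨?_, le_add_self, by simpa using h2⟩
      rw [map_add, h1]
      omega
    · intro a ha
      exact tsub_add_cancel_of_le ((hmem a).1 ha).2.1
    · intro e _
      exact add_tsub_cancel_right e c
  · refine Finset.card_eq_zero.2 (Finset.eq_empty_of_forall_notMem fun a ha => ?_)
    obtain ⟨h1, h2, -⟩ := (hmem a).1 ha
    have := hdeg a h2
    omega

open scoped Classical in
theorem card_standard_eq_sum (J : Ideal (MvPolynomial (Fin N) ℂ)) (k : ℕ) :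
    ((Finset.univ.finsuppAntidiag k).filter
      fun a : Fin N →₀ ℕ => monomial a (1 : ℂ) ∉ J).card =
      ∑ c ∈ standardBox J,
        if c.degree ≤ k then (freeVars J c).card.multichoose (k - c.degree) else 0 := by
  rw [Finset.card_eq_sum_card_fiberwise (f := fun a => a ⊓ lcmExponent J) (t := standardBox J)]
  · refine Finset.sum_congr rfl fun c hc => ?_
    obtain ⟨hcle, hcJ⟩ := mem_standardBox.1 hc
    rw [← card_fiber_inf_lcmExponent hcle, Finset.filter_filter]
    congr 1
    refine Finset.filter_congr fun a _ => and_iff_right_of_imp ?_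
    rintro rfl
    exact fun h => hcJ (monomial_inf_lcmExponent_mem_iff.2 h)
  · intro a ha
    refine Finset.mem_coe.2 (mem_standardBox.2 ⟨inf_le_right, fun h => ?_⟩)
    exact (Finset.mem_filter.1 (Finset.mem_coe.1 ha)).2 (monomial_inf_lcmExponent_mem_iff.1 h)

theorem hilbertFunction_eq_sum (m : MonomialOrder (Fin N))
    {I : Ideal (MvPolynomial (Fin N) ℂ)}
    (hI : I.IsHomogeneous (homogeneousSubmodule (Fin N) ℂ)) (k : ℕ) :
    hilbertFunction I k = ∑ c ∈ standardBox (initialIdeal m I), if c.degree ≤ k then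
      (freeVars (initialIdeal m I) c).card.multichoose (k - c.degree) else 0 := by
  classical
  rw [hilbertFunction_eq_card m hI, card_standard_eq_sum]

/-! ### The K-polynomial -/

theorem coeff_invOneSubPow_eq_multichoose (s n : ℕ) :
    PowerSeries.coeff n (PowerSeries.invOneSubPow ℤ s).val = (s.multichoose n : ℤ) := by
  cases s with
  | zero =>
    rw [PowerSeries.invOneSubPow_zero, Units.val_one, PowerSeries.coeff_one]
    cases n <;> simp
  | succ s =>
    rw [PowerSeries.invOneSubPow_val_succ_eq_mk_add_choose, PowerSeries.coeff_mk,
      Nat.multichoose_eq, show s + 1 + n - 1 = s + n by omega, Nat.choose_symm_add]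

variable (J) in
/-- The K-polynomial read off from the decomposition of the standard monomials into translates of
free commutative monoids. -/
noncomputable def boxKPolynomial : Polynomial ℤ :=
  ∑ c ∈ standardBox J, Polynomial.X ^ c.degree * (1 - Polynomial.X) ^ (N - (freeVars J c).card)

theorem card_freeVars_le (c : Fin N →₀ ℕ) : (freeVars J c).card ≤ N :=
  (Finset.card_le_univ _).trans_eq (Fintype.card_fin N)

theorem isKPolynomial_boxKPolynomial (m : MonomialOrder (Fin N))
    {I : Ideal (MvPolynomial (Fin N) ℂ)}
    (hI : I.IsHomogeneous (homogeneousSubmodule (Fin N) ℂ)) :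
    IsKPolynomial I (boxKPolynomial (initialIdeal m I)) := by
  have hseries : hilbertSeries I = ∑ c ∈ standardBox (initialIdeal m I),
      PowerSeries.X ^ c.degree *
        (PowerSeries.invOneSubPow ℤ (freeVars (initialIdeal m I) c).card).val := by
    ext k
    rw [hilbertSeries, PowerSeries.coeff_mk, hilbertFunction_eq_sum m hI, map_sum, Nat.cast_sum]
    refine Finset.sum_congr rfl fun c _ => ?_
    rw [PowerSeries.coeff_X_pow_mul', coeff_invOneSubPow_eq_multichoose]
    split_ifs <;> simp
  rw [IsKPolynomial, hseries, boxKPolynomial, Finset.sum_mul,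
    ← Polynomial.coeToPowerSeries.ringHom_apply, map_sum]
  refine Finset.sum_congr rfl fun c _ => ?_
  have hinv := (PowerSeries.invOneSubPow ℤ (freeVars (initialIdeal m I) c).card).val_inv
  rw [PowerSeries.invOneSubPow_inv_eq_one_sub_pow] at hinv
  have hpow : (1 - PowerSeries.X : PowerSeries ℤ) ^ N =
      (1 - PowerSeries.X) ^ (freeVars (initialIdeal m I) c).card *
        (1 - PowerSeries.X) ^ (N - (freeVars (initialIdeal m I) c).card) := by
    rw [← pow_add, Nat.add_sub_cancel' (card_freeVars_le c)]
  rw [hpow]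
  simp only [map_mul, map_pow, map_sub, map_one, Polynomial.coeToPowerSeries.ringHom_apply,
    Polynomial.coe_X]
  rw [mul_assoc, ← mul_assoc (PowerSeries.invOneSubPow _ _).val, hinv, one_mul]

theorem trailingCoeff_boxKPolynomial_comp (J : Ideal (MvPolynomial (Fin N) ℂ)) :
    ((boxKPolynomial J).comp (1 - Polynomial.X)).trailingCoeff = ((topBox J).card : ℤ) := by
  rcases (standardBox J).eq_empty_or_nonempty with hempty | hne
  · simp [boxKPolynomial, topBox, hempty]
  set Q : Polynomial ℤ := ∑ c ∈ standardBox J,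
    (1 - Polynomial.X) ^ c.degree * Polynomial.X ^ (maxFree J - (freeVars J c).card) with hQ
  -- `Q` is what remains of `K(1 - t)` after dividing by `t ^ (N - maxFree J)`; its constant term
  -- counts `topBox`
  have hfac : (boxKPolynomial J).comp (1 - Polynomial.X) = Polynomial.X ^ (N - maxFree J) * Q := by
    rw [boxKPolynomial, Polynomial.sum_comp, hQ, Finset.mul_sum]
    refine Finset.sum_congr rfl fun c hc => ?_
    have h1 := card_freeVars_le_maxFree hc
    have h2 : maxFree J ≤ N := Finset.sup_le fun c _ => card_freeVars_le c
    have h3 : N - (freeVars J c).card = (N - maxFree J) + (maxFree J - (freeVars J c).card) := by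
      omega
    rw [h3]
    simp only [Polynomial.mul_comp, Polynomial.pow_comp, Polynomial.sub_comp, Polynomial.X_comp,
      Polynomial.one_comp, sub_sub_cancel]
    ring
  have hQ0 : Q.coeff 0 = ((topBox J).card : ℤ) := by
    rw [Polynomial.coeff_zero_eq_eval_zero, hQ, Polynomial.eval_finsetSum, topBox,
      Finset.card_filter, Nat.cast_sum]
    refine Finset.sum_congr rfl fun c hc => ?_
    have h1 := card_freeVars_le_maxFree hc
    by_cases h : (freeVars J c).card = maxFree J
    · simp [h]
    · have h2 : maxFree J - (freeVars J c).card ≠ 0 := by omega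
      simp [h, h2]
  have hQne : Q.coeff 0 ≠ 0 := by
    rw [hQ0]
    exact_mod_cast (Finset.card_pos.2 (topBox_nonempty hne)).ne'
  rw [hfac, Polynomial.trailingCoeff_mul, Polynomial.trailingCoeff, Polynomial.trailingCoeff,
    Polynomial.natTrailingDegree_X_pow, Polynomial.coeff_X_pow_self, one_mul,
    Polynomial.natTrailingDegree_eq_zero.2 (Or.inr hQne), hQ0]

/-! ### The Hilbert polynomial -/

variable (J) in
/-- The Hilbert polynomial read off from the same decomposition. Elements of the box without free
variables contribute to a single degree only, hence not at all to the Hilbert polynomial. -/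
noncomputable def boxHilbertPolynomial : Polynomial ℚ :=
  ∑ c ∈ (standardBox J).filter (fun c => 0 < (freeVars J c).card),
    Polynomial.preHilbertPoly ℚ ((freeVars J c).card - 1) c.degree

theorem isHilbertPolynomial_boxHilbertPolynomial (m : MonomialOrder (Fin N))
    {I : Ideal (MvPolynomial (Fin N) ℂ)}
    (hI : I.IsHomogeneous (homogeneousSubmodule (Fin N) ℂ)) :
    IsHilbertPolynomial I (boxHilbertPolynomial (initialIdeal m I)) := by
  set J := initialIdeal m I
  refine Filter.eventually_atTop.2 ⟨(standardBox J).sup (fun c => c.degree) + 1, fun k hk => ?_⟩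
  rw [hilbertFunction_eq_sum m hI, boxHilbertPolynomial, Polynomial.eval_finsetSum,
    Finset.sum_filter, Nat.cast_sum]
  refine Finset.sum_congr rfl fun c hc => ?_
  have hck : c.degree < k := (Finset.le_sup (f := fun c : Fin N →₀ ℕ => c.degree) hc).trans_lt hk
  rw [if_pos hck.le]
  change _ = (((freeVars J c).card.multichoose (k - c.degree) : ℕ) : ℚ)
  rcases Nat.eq_zero_or_pos (freeVars J c).card with h0 | hpos
  · obtain ⟨n, hn⟩ : ∃ n, k - c.degree = n + 1 := ⟨k - c.degree - 1, by omega⟩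
    rw [h0, hn]
    simp
  · obtain ⟨s, hs⟩ : ∃ s, (freeVars J c).card = s + 1 := ⟨(freeVars J c).card - 1, by omega⟩
    rw [if_pos hpos, Polynomial.preHilbertPoly_eq_choose_sub_add _ _ hck.le, hs,
      Nat.multichoose_eq, Nat.add_sub_cancel,
      show s + 1 + (k - c.degree) - 1 = (k - c.degree) + s by omega, Nat.choose_symm_add]

theorem leadingCoeff_boxHilbertPolynomial {d : ℕ} (hd : maxFree J = d + 1) :
    (boxHilbertPolynomial J).leadingCoeff * (d.factorial : ℚ) = ((topBox J).card : ℚ) := by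
  have hdeg : (boxHilbertPolynomial J).natDegree ≤ d := by
    refine Polynomial.natDegree_sum_le_of_forall_le _ _ fun c hc => ?_
    rw [Polynomial.natDegree_preHilbertPoly]
    have := card_freeVars_le_maxFree (Finset.mem_filter.1 hc).1
    omega
  have hcoeff : (boxHilbertPolynomial J).coeff d = ((topBox J).card : ℚ) * (d.factorial : ℚ)⁻¹ := by
    have htop : topBox J = ((standardBox J).filter fun c => 0 < (freeVars J c).card).filter
        fun c => (freeVars J c).card = d + 1 := by
      rw [topBox, hd, Finset.filter_filter]
      exact Finset.filter_congr fun c _ => by omega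
    rw [boxHilbertPolynomial, Polynomial.finsetSum_coeff, htop, Finset.card_filter, Nat.cast_sum,
      Finset.sum_mul]
    refine Finset.sum_congr rfl fun c hc => ?_
    have h1 := card_freeVars_le_maxFree (Finset.mem_filter.1 hc).1
    have h2 := (Finset.mem_filter.1 hc).2
    by_cases h : (freeVars J c).card = d + 1
    · rw [h, Nat.add_sub_cancel, Polynomial.coeff_preHilbertPoly_self]
      simp
    · rw [if_neg h, Polynomial.coeff_eq_zero_of_natDegree_lt]
      · simp
      · rw [Polynomial.natDegree_preHilbertPoly]
        omega
  have hne : (topBox J).Nonempty := by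
    refine topBox_nonempty (Finset.nonempty_iff_ne_empty.2 fun h => ?_)
    rw [maxFree, h] at hd
    simp at hd
  have hfact : (d.factorial : ℚ) ≠ 0 := by exact_mod_cast d.factorial_ne_zero
  have hcoeff0 : (boxHilbertPolynomial J).coeff d ≠ 0 := by
    rw [hcoeff]
    exact mul_ne_zero (by exact_mod_cast (Finset.card_pos.2 hne).ne') (inv_ne_zero hfact)
  rw [Polynomial.leadingCoeff, le_antisymm hdeg (Polynomial.le_natDegree_of_ne_zero hcoeff0),
    hcoeff, inv_mul_cancel_right₀ hfact]

end Count

/-! ### Krull dimension -/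

theorem ringKrullDim_eq_of_isIntegral_of_injective {R S : Type*} [CommRing R] [CommRing S]
    [Algebra R S] [Algebra.IsIntegral R S] (hinj : Function.Injective (algebraMap R S)) :
    ringKrullDim S = ringKrullDim R := by
  have : FaithfulSMul R S := (faithfulSMul_iff_algebraMap_injective R S).2 hinj
  apply le_antisymm
  · exact Order.krullDim_le_of_strictMono (PrimeSpectrum.comap (algebraMap R S))
      fun P Q h => Ideal.IsIntegral.comap_lt_comap h
  · refine iSup_le fun l => ?_
    obtain ⟨P, hP, hPl⟩ := (Ideal.nonempty_primesOver (S := S) l.head.asIdeal).some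
    obtain ⟨L, hL, -⟩ := Ideal.exists_ltSeries_of_hasGoingUp (S := S) l P
    exact hL ▸ le_iSup (fun p : LTSeries (PrimeSpectrum S) => (p.length : WithBot ℕ∞)) L

/-- In an algebra that is finite over a polynomial ring in `s` variables, at most `s` elements are
algebraically independent. The transcendence degree is taken modulo a prime that meets the
independent polynomial subring trivially. -/
theorem card_le_of_finite_of_injective {k A : Type*} [Field k] [CommRing A] [Algebra k A] {s : ℕ}
    (g : MvPolynomial (Fin s) k →ₐ[k] A) (hg : g.Finite) {ι : Type*} [Fintype ι]
    (h : MvPolynomial ι k →ₐ[k] A) (hh : Function.Injective h) : Fintype.card ι ≤ s := by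
  have hbot : (⊥ : Ideal (MvPolynomial ι k)) ∈ minimalPrimes (MvPolynomial ι k) := by
    rw [IsDomain.minimalPrimes_eq_singleton_bot]
    rfl
  obtain ⟨q, hq, hqh⟩ :=
    Ideal.exists_comap_eq_of_mem_minimalPrimes_of_injective (f := h.toRingHom) hh ⊥ hbot
  set g' : MvPolynomial (Fin s) k →ₐ[k] A ⧸ q := (Ideal.Quotient.mkₐ k q).comp g with hg'
  set h' : MvPolynomial ι k →ₐ[k] A ⧸ q := (Ideal.Quotient.mkₐ k q).comp h with hh'
  have hint : g'.toRingHom.IsIntegral := by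
    have h1 : (g : MvPolynomial (Fin s) k →+* A).IsIntegral := RingHom.Finite.to_isIntegral hg
    have h2 : (Ideal.Quotient.mk q).IsIntegral :=
      RingHom.isIntegral_of_surjective _ Ideal.Quotient.mk_surjective
    exact h1.trans _ _ h2
  have hinj : Function.Injective h' := by
    refine (injective_iff_map_eq_zero _).2 fun f hf => ?_
    have hfq : h f ∈ q := Ideal.Quotient.eq_zero_iff_mem.1 hf
    have : f ∈ q.comap h.toRingHom := hfq
    rw [hqh] at this
    exact this
  set S : Set (A ⧸ q) := Set.range fun i => g' (X i) with hS
  have hrange : ∀ p, g' p ∈ Algebra.adjoin k S := by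
    intro p
    have : g' = aeval fun i => g' (X i) := by ext i; simp
    rw [this, hS, Algebra.adjoin_range_eq_range_aeval]
    exact ⟨p, rfl⟩
  have halg : Algebra.IsAlgebraic (Algebra.adjoin k S) (A ⧸ q) := by
    have hadj : (algebraMap (Algebra.adjoin k S) (A ⧸ q)).IsIntegral :=
      RingHom.IsIntegral.tower_top (g'.codRestrict _ hrange).toRingHom _ hint
    have : Nontrivial (Algebra.adjoin k S) :=
      ⟨0, 1, fun h => zero_ne_one (congrArg Subtype.val h)⟩
    exact ⟨fun a => IsIntegral.isAlgebraic (hadj a)⟩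
  have hle := Algebra.IsAlgebraic.trdeg_le_cardinalMk k S
  have hcard : Cardinal.mk S ≤ s := by
    simpa using Cardinal.mk_range_le_lift (f := fun i => g' (X i))
  have hind : AlgebraicIndependent k fun i => h' (X i) := by
    have : h' = aeval fun i => h' (X i) := by ext i; simp
    rw [algebraicIndependent_iff_injective_aeval, ← this]
    exact hinj
  have h1 := hind.lift_cardinalMk_le_trdeg
  have h2 := h1.trans (Cardinal.lift_le.2 (hle.trans hcard))
  simpa using h2

/-! ### Growth of the quotient ring -/

theorem multichoose_succ_le_pow (s n : ℕ) : (s + 1).multichoose n ≤ (n + 1) ^ s := by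
  induction s generalizing n with
  | zero => simp
  | succ s ih =>
    induction n with
    | zero => simp
    | succ n ihn =>
      calc (s + 1 + 1).multichoose (n + 1)
          = (s + 1).multichoose (n + 1) + (s + 1 + 1).multichoose n :=
            Nat.multichoose_succ_succ _ _
        _ ≤ (n + 1 + 1) ^ s + (n + 1) ^ (s + 1) := add_le_add (ih _) ihn
        _ ≤ (n + 1 + 1) ^ s + (n + 1 + 1) ^ s * (n + 1) := by
            rw [pow_succ (n + 1)]
            gcongr
            omega
        _ = (n + 1 + 1) ^ (s + 1) := by ring

theorem sum_multichoose (s n : ℕ) :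
    ∑ j ∈ Finset.range (n + 1), s.multichoose j = (s + 1).multichoose n := by
  induction n with
  | zero => simp
  | succ n ih => rw [Finset.sum_range_succ, ih, Nat.multichoose_succ_succ, add_comm]

theorem sum_range_shift_le (f : ℕ → ℕ) (d n : ℕ) :
    ∑ k ∈ Finset.range n, (if d ≤ k then f (k - d) else 0) ≤ ∑ j ∈ Finset.range n, f j := by
  rw [← Finset.sum_filter]
  have hinj : Set.InjOn (fun k => k - d) ((Finset.range n).filter fun k => d ≤ k) := by
    intro a ha b hb hab
    have h1 := (Finset.mem_filter.1 (Finset.mem_coe.1 ha)).2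
    have h2 := (Finset.mem_filter.1 (Finset.mem_coe.1 hb)).2
    have h3 : a - d = b - d := hab
    omega
  rw [← Finset.sum_image (f := f) hinj]
  refine Finset.sum_le_sum_of_subset fun j hj => ?_
  obtain ⟨k, hk, rfl⟩ := Finset.mem_image.1 hj
  have := Finset.mem_range.1 (Finset.mem_filter.1 hk).1
  exact Finset.mem_range.2 (by omega)

variable {N : ℕ}

theorem sum_hilbertFunction_le (m : MonomialOrder (Fin N))
    {I : Ideal (MvPolynomial (Fin N) ℂ)}
    (hI : I.IsHomogeneous (homogeneousSubmodule (Fin N) ℂ)) (n : ℕ) :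
    ∑ k ∈ Finset.range (n + 1), hilbertFunction I k ≤
      (standardBox (initialIdeal m I)).card * (n + 1) ^ maxFree (initialIdeal m I) := by
  simp_rw [hilbertFunction_eq_sum m hI]
  rw [Finset.sum_comm, ← smul_eq_mul, ← Finset.sum_const]
  refine Finset.sum_le_sum fun c hc => ?_
  calc _ ≤ ∑ j ∈ Finset.range (n + 1), (freeVars (initialIdeal m I) c).card.multichoose j :=
        sum_range_shift_le _ _ _
    _ ≤ (n + 1) ^ (freeVars (initialIdeal m I) c).card := by
        rw [sum_multichoose]
        exact multichoose_succ_le_pow _ _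
    _ ≤ _ := Nat.pow_le_pow_right n.succ_pos (card_freeVars_le_maxFree hc)

theorem exists_submodule_finrank_le (I : Ideal (MvPolynomial (Fin N) ℂ)) (n : ℕ) :
    ∃ W : Submodule ℂ (MvPolynomial (Fin N) ℂ ⧸ I), Module.Finite ℂ W ∧
      Module.finrank ℂ W ≤ ∑ k ∈ Finset.range n, hilbertFunction I k ∧
      ∀ k < n, (homogeneousSubmodule (Fin N) ℂ k).map (Ideal.Quotient.mkₐ ℂ I).toLinearMap ≤ W := by
  induction n with
  | zero => exact ⟨⊥, inferInstance, by simp, by simp⟩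
  | succ n ih =>
    obtain ⟨W, hfin, hrank, hle⟩ := ih
    have hfg : Module.Finite ℂ
        ((homogeneousSubmodule (Fin N) ℂ n).map (Ideal.Quotient.mkₐ ℂ I).toLinearMap) :=
      Module.Finite.iff_fg.2 ((homogeneousSubmodule_fg _ _ n).map _)
    refine ⟨W ⊔ (homogeneousSubmodule (Fin N) ℂ n).map (Ideal.Quotient.mkₐ ℂ I).toLinearMap,
      inferInstance, ?_, fun k hk => ?_⟩
    · rw [Finset.sum_range_succ]
      exact (Submodule.finrank_add_le_finrank_add_finrank _ _).trans (Nat.add_le_add_right hrank _)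
    · rcases Nat.lt_succ_iff_lt_or_eq.1 hk with h | rfl
      · exact (hle k h).trans le_sup_left
      · exact le_sup_right

/-- The classes of polynomials of degree at most `n` span a space of dimension `O(n ^ D)`, where
`D` is the largest number of free variables. -/
theorem exists_submodule_finrank_le_pow (m : MonomialOrder (Fin N))
    {I : Ideal (MvPolynomial (Fin N) ℂ)}
    (hI : I.IsHomogeneous (homogeneousSubmodule (Fin N) ℂ)) (n : ℕ) :
    ∃ W : Submodule ℂ (MvPolynomial (Fin N) ℂ ⧸ I), Module.Finite ℂ W ∧
      Module.finrank ℂ W ≤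
        (standardBox (initialIdeal m I)).card * (n + 1) ^ maxFree (initialIdeal m I) ∧
      ∀ f : MvPolynomial (Fin N) ℂ, f.totalDegree ≤ n → Ideal.Quotient.mkₐ ℂ I f ∈ W := by
  obtain ⟨W, hfin, hrank, hle⟩ := exists_submodule_finrank_le I (n + 1)
  refine ⟨W, hfin, hrank.trans (sum_hilbertFunction_le m hI n), fun f hf => ?_⟩
  rw [← sum_homogeneousComponent f, map_sum]
  refine W.sum_mem fun k hk => hle k ?_ ⟨_, homogeneousComponent_mem k f, rfl⟩
  have := Finset.mem_range.1 hk
  omega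

theorem le_of_pow_le_mul_pow {s D B : ℕ} (h : ∀ n : ℕ, (n + 1) ^ s ≤ B * (n + 1) ^ D) :
    s ≤ D := by
  by_contra hlt
  -- at `n = B` the factor `n + 1` gained on the left already exceeds the constant
  have h1 := h B
  have h2 : (B + 1) ^ (D + 1) ≤ (B + 1) ^ s := Nat.pow_le_pow_right B.succ_pos (by omega)
  have h3 : (B + 1) * (B + 1) ^ D ≤ B * (B + 1) ^ D := by
    rw [← pow_succ']
    exact h2.trans h1
  have h4 := Nat.le_of_mul_le_mul_right h3 (by positivity)
  omega

/-- A polynomial subring in `s` variables forces growth of order at least `n ^ s`. -/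
theorem le_maxFree_of_injective (m : MonomialOrder (Fin N))
    {I : Ideal (MvPolynomial (Fin N) ℂ)}
    (hI : I.IsHomogeneous (homogeneousSubmodule (Fin N) ℂ)) {s : ℕ}
    (g : MvPolynomial (Fin s) ℂ →ₐ[ℂ] MvPolynomial (Fin N) ℂ ⧸ I) (hg : Function.Injective g) :
    s ≤ maxFree (initialIdeal m I) := by
  have hlift : ∀ i, ∃ f : MvPolynomial (Fin N) ℂ, Ideal.Quotient.mkₐ ℂ I f = g (X i) :=
    fun i => Ideal.Quotient.mk_surjective _
  choose f hf using hlift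
  set e := ∑ i, (f i).totalDegree with he
  set D := maxFree (initialIdeal m I) with hD
  refine le_of_pow_le_mul_pow (B := (standardBox (initialIdeal m I)).card * (e + 1) ^ D)
    fun n => ?_
  obtain ⟨W, hfin, hrank, hW⟩ := exists_submodule_finrank_le_pow m hI (n * e)
  -- the monomials in the `s` variables with all exponents at most `n`; their images have
  -- representatives of degree at most `n * e`
  let b : (Fin s → Fin (n + 1)) → (Fin s →₀ ℕ) :=
    fun c => Finsupp.equivFunOnFinite.symm fun i => (c i : ℕ)
  have hb : Function.Injective b := by
    intro c c' h
    funext i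
    exact Fin.ext (DFunLike.congr_fun h i)
  have hli : LinearIndependent ℂ fun c => g (monomial (b c) 1) := by
    have h := (basisMonomials (Fin s) ℂ).linearIndependent.comp b hb
    rw [coe_basisMonomials] at h
    exact h.map' g.toLinearMap (LinearMap.ker_eq_bot.2 hg)
  have hmem : ∀ c, g (monomial (b c) 1) ∈ W := by
    intro c
    have heq : g (monomial (b c) 1) = Ideal.Quotient.mkₐ ℂ I (∏ i, f i ^ (c i : ℕ)) := by
      rw [monomial_eq, Finsupp.prod_fintype _ _ fun _ => pow_zero _]
      simp only [map_one, one_mul, map_prod, map_pow, hf]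
      rfl
    rw [heq]
    refine hW _ ((totalDegree_finsetProd _ _).trans ?_)
    rw [he, Finset.mul_sum]
    refine Finset.sum_le_sum fun i _ => (totalDegree_pow _ _).trans ?_
    exact Nat.mul_le_mul_right _ (Nat.lt_succ_iff.1 (c i).2)
  have hliW : LinearIndependent ℂ fun c => (⟨g (monomial (b c) 1), hmem c⟩ : W) :=
    LinearIndependent.of_comp W.subtype hli
  have hcard := hliW.fintype_card_le_finrank
  rw [Fintype.card_fun, Fintype.card_fin, Fintype.card_fin] at hcard
  calc (n + 1) ^ s ≤ (standardBox (initialIdeal m I)).card * (n * e + 1) ^ D := hcard.trans hrank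
    _ ≤ (standardBox (initialIdeal m I)).card * ((e + 1) * (n + 1)) ^ D := by
        gcongr
        nlinarith
    _ = _ := by rw [mul_pow, mul_assoc]

/-- The free variables of an element of the standard box are algebraically independent modulo
`I`: the leading monomial of a relation would be a monomial in these variables that lies in the
initial ideal. -/
theorem injective_rename_freeVars (m : MonomialOrder (Fin N))
    {I : Ideal (MvPolynomial (Fin N) ℂ)} {c : Fin N →₀ ℕ}
    (hc : c ∈ standardBox (initialIdeal m I)) :
    Function.Injective ((Ideal.Quotient.mkₐ ℂ I).comp
      (rename (Subtype.val : freeVars (initialIdeal m I) c → Fin N))) := by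
  refine (injective_iff_map_eq_zero _).2 fun p hp => ?_
  by_contra hp0
  set f := rename (Subtype.val : freeVars (initialIdeal m I) c → Fin N) p with hf
  have hf0 : f ≠ 0 := by
    rw [hf]
    exact fun h => hp0 (rename_injective _ Subtype.val_injective (h.trans (map_zero _).symm))
  have hfI : f ∈ I := Ideal.Quotient.eq_zero_iff_mem.1 hp
  have hmem : monomial (m.degree f) (1 : ℂ) ∈ initialIdeal m I :=
    (monomial_mem_initialIdeal_iff m I _).2 ⟨f, hfI, hf0, rfl⟩
  refine (mem_standardBox.1 hc).2 (monomial_mem_of_le ?_ (monomial_inf_lcmExponent_mem_iff.2 hmem))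
  classical
  intro i
  rw [Finsupp.inf_apply, lcmExponent_apply]
  by_cases hi : c i = maxExponent (initialIdeal m I) i
  · exact inf_le_right.trans hi.ge
  · have hsupp := m.degree_mem_support hf0
    rw [hf, support_rename_of_injective Subtype.val_injective] at hsupp
    obtain ⟨d, -, hd⟩ := Finset.mem_image.1 hsupp
    rw [← hf] at hd
    rw [← hd, Finsupp.mapDomain_of_notMem_range]
    · simp
    · rintro ⟨⟨j, hj⟩, rfl⟩
      exact hi (Finset.mem_filter.1 hj).2

theorem ringKrullDim_quotient_eq_maxFree (m : MonomialOrder (Fin N))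
    {I : Ideal (MvPolynomial (Fin N) ℂ)}
    (hI : I.IsHomogeneous (homogeneousSubmodule (Fin N) ℂ)) (hne : I ≠ ⊤) :
    ringKrullDim (MvPolynomial (Fin N) ℂ ⧸ I) = (maxFree (initialIdeal m I) : WithBot ℕ∞) := by
  have : Nontrivial (MvPolynomial (Fin N) ℂ ⧸ I) := Ideal.Quotient.nontrivial_iff.2 hne
  obtain ⟨s, g, hg, hfin⟩ := exists_finite_inj_algHom_of_fg ℂ (MvPolynomial (Fin N) ℂ ⧸ I)
  have hdim : ringKrullDim (MvPolynomial (Fin N) ℂ ⧸ I) = (s : WithBot ℕ∞) := by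
    algebraize [g.toRingHom]
    have : Algebra.IsIntegral (MvPolynomial (Fin s) ℂ) (MvPolynomial (Fin N) ℂ ⧸ I) :=
      ⟨RingHom.Finite.to_isIntegral hfin⟩
    rw [ringKrullDim_eq_of_isIntegral_of_injective (R := MvPolynomial (Fin s) ℂ) hg]
    simp
  have h0 : (standardBox (initialIdeal m I)).Nonempty := by
    refine ⟨0, mem_standardBox.2 ⟨zero_le, fun h => ?_⟩⟩
    obtain ⟨f, hfI, hf0, hf⟩ := (monomial_mem_initialIdeal_iff m I 0).1 h
    rw [m.eq_C_of_degree_eq_zero hf] at hfI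
    refine hne (Ideal.eq_top_of_isUnit_mem _ hfI ?_)
    exact (IsUnit.mk0 _ (m.leadingCoeff_ne_zero_iff.2 hf0)).map C
  obtain ⟨c, hc⟩ := topBox_nonempty h0
  obtain ⟨hc, hcD⟩ := Finset.mem_filter.1 hc
  have hle : maxFree (initialIdeal m I) ≤ s := by
    have := card_le_of_finite_of_injective g hfin _ (injective_rename_freeVars m hc)
    rwa [Fintype.card_coe, hcD] at this
  rw [hdim, le_antisymm (le_maxFree_of_injective m hI g hg) hle]

/-! ### Radical initial ideals -/

section Radical

theorem initialIdeal_eq_span_minGenerators (m : MonomialOrder (Fin N))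
    (I : Ideal (MvPolynomial (Fin N) ℂ)) :
    initialIdeal m I =
      Ideal.span ((fun a => monomial a (1 : ℂ)) '' minGenerators (initialIdeal m I)) := by
  apply le_antisymm
  · conv_lhs => rw [initialIdeal, m.span_leadingTerm_eq_span_monomial']
    rw [Ideal.span_le]
    rintro _ ⟨f, ⟨hf, hf0⟩, rfl⟩
    obtain ⟨g, hg, hle⟩ :=
      exists_minGenerator_le ((monomial_mem_initialIdeal_iff m I _).2 ⟨f, hf, hf0, rfl⟩)
    exact monomial_mem_of_le hle (Ideal.subset_span ⟨g, hg, rfl⟩)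
  · rw [Ideal.span_le]
    rintro _ ⟨g, hg, rfl⟩
    exact hg.1

variable {J : Ideal (MvPolynomial (Fin N) ℂ)}

/-- If `x^g` lies in a radical ideal, so does its squarefree part, a power of which is a multiple
of `x^g`. -/
theorem minGenerator_apply_le_one (hJ : J.IsRadical) {g : Fin N →₀ ℕ} (hg : g ∈ minGenerators J)
    (i : Fin N) : g i ≤ 1 := by
  set g' : Fin N →₀ ℕ := g.mapRange (fun n => min n 1) rfl with hg'
  have hmem : monomial g' (1 : ℂ) ∈ J := by
    refine hJ ⟨g.degree, ?_⟩
    rw [monomial_pow, one_pow]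
    refine monomial_mem_of_le (fun j => ?_) hg.1
    have h1 : g j ≤ g.degree := Finsupp.le_degree j g
    change g j ≤ g.degree * min (g j) 1
    rcases Nat.eq_zero_or_pos (g j) with h | h
    · simp [h]
    · rw [min_eq_right h, mul_one]
      exact h1
  have hle : g ≤ g' := hg.2 hmem fun j => min_le_left (g j) 1
  exact (hle i).trans (min_le_right (g i) 1)

theorem monomial_eq_prod_X_support {a : Fin N →₀ ℕ} (ha : ∀ i, a i ≤ 1) :
    monomial a (1 : ℂ) = ∏ i ∈ a.support, X i := by
  rw [monomial_eq, C_1, one_mul, Finsupp.prod]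
  refine Finset.prod_congr rfl fun i hi => ?_
  rw [le_antisymm (ha i) (Nat.one_le_iff_ne_zero.2 (Finsupp.mem_support_iff.1 hi)), pow_one]

theorem ncard_tablet_eq_of_isRadical (hJ : J.IsRadical)
    (hspan : J = Ideal.span ((fun a => monomial a (1 : ℂ)) '' minGenerators J)) :
    (tablet J).ncard = (tablet (polarization J)).ncard := by
  have hmax : ∀ i, maxExponent J i ≤ 1 := fun i => Finset.sup_le fun g hg =>
    minGenerator_apply_le_one hJ ((minGenerators_finite J).mem_toFinset.1 hg) i
  let e : PolarVar J ↪ Fin N := ⟨Sigma.fst, by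
    rintro ⟨i, k⟩ ⟨j, l⟩ (rfl : i = j)
    have hkl : k = l := Fin.ext (by have := hmax i; omega)
    rw [hkl]⟩
  have hedge : ∀ g ∈ minGenerators J, (polarEdge J g).map e = g.support := by
    intro g hg
    ext i
    simp only [Finset.mem_map, Finsupp.mem_support_iff, polarEdge, Finset.mem_filter,
      Finset.mem_univ, true_and]
    constructor
    · rintro ⟨v, hv, rfl⟩
      exact Nat.ne_zero_of_lt hv
    · intro hi
      have hpos := Nat.pos_of_ne_zero hi
      exact ⟨⟨i, ⟨0, hpos.trans_le (minGenerator_le_lcmExponent hg i)⟩⟩, hpos, rfl⟩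
  have hJ' : J = Ideal.span ((fun F : Finset (Fin N) => ∏ v ∈ F, (X v : MvPolynomial (Fin N) ℂ)) ''
      (Finset.map e '' (polarEdge J '' minGenerators J))) := by
    conv_lhs => rw [hspan]
    rw [Set.image_image, Set.image_image]
    congr 1
    refine Set.image_congr fun g hg => ?_
    rw [hedge g hg, monomial_eq_prod_X_support fun i => minGenerator_apply_le_one hJ hg i]
  rw [polarization_eq_span, tablet_span_prod_X, ← ncard_minCovers_map e, ← tablet_span_prod_X,
    ← hJ']

end Radical

end Tablet

theorem theorem1p1 (N : ℕ) (I : Ideal (MvPolynomial (Fin N) ℂ))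
    (hI : I.IsHomogeneous (MvPolynomial.homogeneousSubmodule (Fin N) ℂ))
    (m : MonomialOrder (Fin N)) :
    (∀ d : ℕ, ringKrullDim (MvPolynomial (Fin N) ℂ ⧸ I) = ((d + 1 : ℕ) : WithBot ℕ∞) →
      ∃ h : Polynomial ℚ, Tablet.IsHilbertPolynomial I h ∧
        h.leadingCoeff * (d.factorial : ℚ) =
          ((Tablet.tablet (Tablet.polarization (Tablet.initialIdeal m I))).ncard : ℚ)) ∧
    (∃ K : Polynomial ℤ, Tablet.IsKPolynomial I K ∧
      (K.comp (1 - Polynomial.X)).trailingCoeff =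
        ((Tablet.tablet (Tablet.polarization (Tablet.initialIdeal m I))).ncard : ℤ)) ∧
    ((Tablet.initialIdeal m I).IsRadical →
      (Tablet.tablet (Tablet.initialIdeal m I)).ncard =
        (Tablet.tablet (Tablet.polarization (Tablet.initialIdeal m I))).ncard) := by
  rw [Tablet.ncard_tablet_polarization]
  refine ⟨fun d hd => ?_, ?_, fun hrad => ?_⟩
  · have hne : I ≠ ⊤ := by
      rintro rfl
      have := Ideal.Quotient.subsingleton_iff.2 (rfl : (⊤ : Ideal (MvPolynomial (Fin N) ℂ)) = ⊤)
      rw [ringKrullDim_eq_bot_of_subsingleton] at hd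
      exact absurd hd.symm (WithBot.coe_ne_bot)
    rw [Tablet.ringKrullDim_quotient_eq_maxFree m hI hne] at hd
    exact ⟨Tablet.boxHilbertPolynomial (Tablet.initialIdeal m I),
      Tablet.isHilbertPolynomial_boxHilbertPolynomial m hI,
      Tablet.leadingCoeff_boxHilbertPolynomial (by exact_mod_cast hd)⟩
  · exact ⟨Tablet.boxKPolynomial (Tablet.initialIdeal m I),
      Tablet.isKPolynomial_boxKPolynomial m hI,
      Tablet.trailingCoeff_boxKPolynomial_comp _⟩
  · rw [← Tablet.ncard_tablet_polarization]
    exact Tablet.ncard_tablet_eq_of_isRadical hrad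
      (Tablet.initialIdeal_eq_span_minGenerators m I)
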